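/- Let $(M,g)$ be a 4-dimensional spacetime, i.e. a smooth 4-manifold with a smooth Lorentzian metric $g$ of signature $(-,+,+,+)$. For events $A,B\in M$ write $A\lozenge B$ if $A$ and $B$ are connected by a light-like geodesic line of $g$, i.e. there are a smooth (affinely parametrized) geodesic $\gamma$ of the Levi-Civita connection of $g$, defined on an open interval, with $\dot\gamma\neq 0$ and $g(\dot\gamma,\dot\gamma)=0$ everywhere, and parameter values $s,t$ in the interval with $\gamma(s)=A$, $\gamma(t)=B$. The spacetime $(M,g)$ is called well-stitched if for any eight pairwise different events $A,B,C,D,E,F,G,H\in M$ the fifteen relations $$A\lozenge E,\ A\lozenge F,\ A\lozenge G,\ A\lozenge H,\ B\lozenge E,\ B\lozenge F,\ B\lozenge G,\ B\lozenge H,\ C\lozenge E,\ C\lozenge F,\ C\lozenge G,\ C\lozenge H,\ D\lozenge E,\ D\lozenge F,\ D\lozenge G$$ imply $D\lozenge H$. The spacetime $(M,g)$ is called conformally flat if it can be mapped onto Minkowski spacetime by a conformal transformation, i.e. there are a diffeomorphism $\varphi\colon M\to\mathbb R^4$ (onto $\mathbb R^4$) and a nowhere vanishing function $\Omega\colon M\to\mathbb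 R$ with $\varphi^*\eta=\Omega^2 g$, where $\eta=-dt^2+dx^2+dy^2+dz^2$. Then every 4-dimensional conformally flat spacetime is well-stitched. -/

import Mathlib

open Set
open scoped Manifold ContDiff

noncomputable section

namespace Spacetime

/-- The coordinate space `ℝ⁴`; coordinate `0` is the time `t`, coordinates `1, 2, 3` are
`x, y, z`. -/
abbrev R4 : Type := EuclideanSpace ℝ (Fin 4)

/-- The manifold `ℝ⁴` has its identity chart (stated so that instance search finds it first). -/
instance R4.instChartedSpace : ChartedSpace R4 R4 := chartedSpaceSelf R4

/-- The matrix `η = diag(-1, 1, 1, 1)` (units with `c = 1`). -/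
def eta : Matrix (Fin 4) (Fin 4) ℝ := Matrix.diagonal ![-1, 1, 1, 1]

/-- The Minkowski scalar product `-a_t b_t + a_x b_x + a_y b_y + a_z b_z` on `ℝ⁴`. -/
def minkowskiForm : R4 →L[ℝ] R4 →L[ℝ] ℝ :=
  ∑ i : Fin 4, ∑ j : Fin 4, eta i j •
    (EuclideanSpace.proj i : R4 →L[ℝ] ℝ).smulRight (EuclideanSpace.proj j : R4 →L[ℝ] ℝ)

/-- A smooth Lorentzian metric (signature `(-,+,+,+)`) on a smooth 4-manifold `M`: a smooth field
of symmetric bilinear forms on the tangent spaces, each of which has the matrix `η` in a suitable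
basis. -/
structure LorentzMetric (M : Type*) [TopologicalSpace M] [ChartedSpace R4 M]
    [IsManifold (𝓡 4) ∞ M] where
  /-- The scalar product of tangent vectors. -/
  inner (p : M) : TangentSpace (𝓡 4) p →L[ℝ] TangentSpace (𝓡 4) p →L[ℝ] ℝ
  symm (p : M) (u v : TangentSpace (𝓡 4) p) : inner p u v = inner p v u
  signature (p : M) : ∃ b : Module.Basis (Fin 4) ℝ (TangentSpace (𝓡 4) p),
    ∀ i j, inner p (b i) (b j) = eta i j
  contMDiff : ContMDiff (𝓡 4) ((𝓡 4).prod 𝓘(ℝ, R4 →L[ℝ] R4 →L[ℝ] ℝ)) ∞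
    (fun p ↦ Bundle.TotalSpace.mk' (R4 →L[ℝ] R4 →L[ℝ] ℝ)
      (E := fun p : M ↦ TangentSpace (𝓡 4) p →L[ℝ] TangentSpace (𝓡 4) p →L[ℝ] ℝ) p (inner p))

theorem minkowskiForm_apply (u v : R4) :
    minkowskiForm u v = ∑ i : Fin 4, ∑ j : Fin 4, eta i j * (u i * v j) := by
  simp [minkowskiForm]

theorem minkowskiForm_symm (u v : R4) : minkowskiForm u v = minkowskiForm v u := by
  rw [minkowskiForm_apply, minkowskiForm_apply, Finset.sum_comm]
  refine Finset.sum_congr rfl fun i _ ↦ Finset.sum_congr rfl fun j _ ↦ ?_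
  have h : eta j i = eta i j :=
    congrFun (congrFun (Matrix.diagonal_transpose (![-1, 1, 1, 1] : Fin 4 → ℝ)) i) j
  rw [h, mul_comm (u j)]

/-- The form `η` on the tangent space of `ℝ⁴` at `p`. -/
def minkowskiInner (p : R4) : TangentSpace (𝓡 4) p →L[ℝ] TangentSpace (𝓡 4) p →L[ℝ] ℝ :=
  ((NormedSpace.fromTangentSpace p).symm.arrowCongr
    ((NormedSpace.fromTangentSpace p).symm.arrowCongr (ContinuousLinearEquiv.refl ℝ ℝ)))
    minkowskiForm

theorem minkowskiInner_apply (p : R4) (u v : TangentSpace (𝓡 4) p) :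
    minkowskiInner p u v = minkowskiForm (NormedSpace.fromTangentSpace p u)
      (NormedSpace.fromTangentSpace p v) := by
  simp [minkowskiInner]

/-- Minkowski spacetime: `ℝ⁴` with the constant metric `η`. -/
def minkowski : LorentzMetric R4 where
  inner := minkowskiInner
  symm p u v := by simp only [minkowskiInner_apply, minkowskiForm_symm]
  signature p := by
    refine ⟨(EuclideanSpace.basisFun (Fin 4) ℝ).toBasis.map
      (NormedSpace.fromTangentSpace p).symm.toLinearEquiv, fun i j ↦ ?_⟩
    simp [minkowskiInner_apply, minkowskiForm_apply]
  contMDiff := by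
    intro x
    rw [Bundle.contMDiffAt_section]
    refine (contMDiffAt_const (c := minkowskiForm)).congr_of_eventuallyEq
      (Filter.Eventually.of_forall fun y ↦ ?_)
    ext v w
    have hV (z : R4) : (trivializationAt R4 (TangentSpace (𝓡 4)) x).symmL ℝ y z
        = (NormedSpace.fromTangentSpace y).symm z :=
      congrArg (fun L : R4 →L[ℝ] R4 ↦ L z) (TangentBundle.symmL_model_space (F := R4) x y)
    change ContinuousLinearMap.inCoordinates R4 (TangentSpace (𝓡 4)) (R4 →L[ℝ] ℝ)
      (fun p : R4 ↦ TangentSpace (𝓡 4) p →L[ℝ] ℝ) x y x y (minkowskiInner y) v w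
      = minkowskiForm v w
    rw [ContinuousLinearMap.inCoordinates, ContinuousLinearMap.comp_apply,
      ContinuousLinearMap.comp_apply, hV]
    have hmem : y ∈ (trivializationAt (R4 →L[ℝ] ℝ)
        (fun p : R4 ↦ TangentSpace (𝓡 4) p →L[ℝ] ℝ) x).baseSet := by
      rw [hom_trivializationAt_baseSet]
      exact ⟨mem_univ y, mem_univ y⟩
    rw [Bundle.Trivialization.continuousLinearMapAt_apply,
      Bundle.Trivialization.coe_linearMapAt_of_mem _ hmem]
    change ContinuousLinearMap.inCoordinates R4 (TangentSpace (𝓡 4)) ℝ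
      (Bundle.Trivial R4 ℝ) x y x y
      (minkowskiInner y ((NormedSpace.fromTangentSpace y).symm v)) w = minkowskiForm v w
    rw [ContinuousLinearMap.inCoordinates, ContinuousLinearMap.comp_apply,
      ContinuousLinearMap.comp_apply, hV, minkowskiInner_apply]
    simp

variable {M : Type*} [TopologicalSpace M] [ChartedSpace R4 M] [IsManifold (𝓡 4) ∞ M]

/-- The metric written in the chart of `M` around `p₀`: the scalar product at the point with
coordinates `y` of the two tangent vectors with coordinates `u` and `v`. -/
def LorentzMetric.coord (g : LorentzMetric M) (p₀ : M) (y u v : R4) : ℝ :=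
  g.inner ((extChartAt (𝓡 4) p₀).symm y)
    (mfderiv 𝓘(ℝ, R4) (𝓡 4) (extChartAt (𝓡 4) p₀).symm y
      ((NormedSpace.fromTangentSpace y).symm u))
    (mfderiv 𝓘(ℝ, R4) (𝓡 4) (extChartAt (𝓡 4) p₀).symm y
      ((NormedSpace.fromTangentSpace y).symm v))

/-- The Christoffel symbols of the first kind (of the Levi-Civita connection) in the chart around
`p₀`, at the point with coordinates `y`, contracted with `u`, `v` and `w`:
`Γ_{k,ij} uⁱ vʲ wᵏ = ½ (∂ᵢ g_{jk} + ∂ⱼ g_{ik} - ∂ₖ g_{ij}) uⁱ vʲ wᵏ`. -/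
def LorentzMetric.christoffel (g : LorentzMetric M) (p₀ : M) (y u v w : R4) : ℝ :=
  (1 / 2) * (fderiv ℝ (fun z ↦ g.coord p₀ z v w) y u
    + fderiv ℝ (fun z ↦ g.coord p₀ z u w) y v
    - fderiv ℝ (fun z ↦ g.coord p₀ z u v) y w)

/-- The geodesic equation for the curve `γ` at the parameter value `t`, in the chart around `γ t`
and with the free index lowered:
`g_{kl} c̈ˡ + Γ_{k,ij} ċⁱ ċʲ = 0`, where `c` is the curve in coordinates. The metric being
nondegenerate, this is `c̈ᵏ + Γᵏ_{ij} ċⁱ ċʲ = 0`; the equation does not depend on the chart. -/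
def GeodesicEqAt (g : LorentzMetric M) (γ : ℝ → M) (t : ℝ) : Prop :=
  let c : ℝ → R4 := fun s ↦ extChartAt (𝓡 4) (γ t) (γ s)
  ∀ w : R4, g.coord (γ t) (c t) (deriv (deriv c) t) w
    + g.christoffel (γ t) (c t) (deriv c t) (deriv c t) w = 0

/-- The velocity of a curve. -/
def velocity (γ : ℝ → M) (t : ℝ) : TangentSpace (𝓡 4) (γ t) :=
  mfderiv 𝓘(ℝ, ℝ) (𝓡 4) γ t ((NormedSpace.fromTangentSpace t).symm (1 : ℝ))

/-- A tangent vector is light-like (null) if it is nonzero and its square is zero. -/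
def IsLightlike (g : LorentzMetric M) {p : M} (v : TangentSpace (𝓡 4) p) : Prop :=
  v ≠ 0 ∧ g.inner p v v = 0

/-- On the open interval `J` (not necessarily bounded), `γ` is a smooth, affinely parametrized
geodesic with light-like velocity. -/
structure IsLightlikeGeodesicOn (g : LorentzMetric M) (γ : ℝ → M) (J : Set ℝ) : Prop where
  isOpen : IsOpen J
  ordConnected : J.OrdConnected
  smooth : ContMDiffOn 𝓘(ℝ, ℝ) (𝓡 4) ∞ γ J
  geodesic : ∀ t ∈ J, GeodesicEqAt g γ t
  lightlike : ∀ t ∈ J, IsLightlike g (velocity γ t)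

/-- The relation `A ◇ B`: the events `A` and `B` are connected by a light-like geodesic line. -/
def LightCone (g : LorentzMetric M) (A B : M) : Prop :=
  ∃ (γ : ℝ → M) (J : Set ℝ), IsLightlikeGeodesicOn g γ J ∧
    ∃ s ∈ J, ∃ t ∈ J, γ s = A ∧ γ t = B

/-- A 4-dimensional spacetime is well-stitched if, for any eight pairwise different events,
fifteen of the sixteen relations between `A, B, C, D` and `E, F, G, H` imply the sixteenth. -/
def WellStitched (g : LorentzMetric M) : Prop :=
  ∀ A B C D E F G H : M, [A, B, C, D, E, F, G, H].Nodup →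
    LightCone g A E → LightCone g A F → LightCone g A G → LightCone g A H →
    LightCone g B E → LightCone g B F → LightCone g B G → LightCone g B H →
    LightCone g C E → LightCone g C F → LightCone g C G → LightCone g C H →
    LightCone g D E → LightCone g D F → LightCone g D G →
    LightCone g D H

/-- A spacetime is conformally flat if it can be mapped onto Minkowski spacetime by a conformal
transformation: a diffeomorphism `φ` onto `ℝ⁴` with `φ^* η = Ω² g` for a nowhere vanishing function
`Ω` (the factor `Ω²` is then automatically smooth). -/
def ConformallyFlat (g : LorentzMetric M) : Prop :=
  ∃ (φ : M ≃ₘ⟮𝓡 4, 𝓡 4⟯ R4) (Ω : M → ℝ), (∀ p, Ω p ≠ 0) ∧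
    ∀ (p : M) (u v : TangentSpace (𝓡 4) p),
      minkowski.inner (φ p) (mfderiv (𝓡 4) (𝓡 4) φ p u) (mfderiv (𝓡 4) (𝓡 4) φ p v)
        = Ω p ^ 2 * g.inner p u v

end Spacetime

end

/-!
In global coordinates in which `g = λ η`, a curve `x` with null velocity is a geodesic if and only
if `λ(x) x'` is constant. Hence the light-like geodesics are reparametrized null lines, and the
relation `◇` between different events is null separation in Minkowski space.

Null separation of `a` and `b` is orthogonality of their lifts `(a, 1, η(a, a))` and
`(b, 1, η(b, b))` to the null cone of a nondegenerate form on `ℝ⁶`. If the lifts of `A`, `B`, `C`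
and those of `E`, `F`, `G` are linearly independent, they span two 3-dimensional subspaces that are
orthogonal complements of each other; the lift of `H` lies in the second one and the lift of `D` is
orthogonal to it. Independence fails only if two of three points are null separated. In that case
every point null separated from both of them lies on the line through them, and a point that is null
separated from two points of a null line is null separated from all of its points.
-/

noncomputable section

namespace Spacetime

open Filter Topology

section QuadraticForm

open Module QuadraticMap

variable {K V : Type*} [Field K] [AddCommGroup V] [Module K V] {Q : QuadraticForm K V}

/-- Two points of the affine space `V` are null separated if their difference is a null vector of
the quadratic form `Q`. -/
def NullSeparated (Q : QuadraticForm K V) (a b : V) : Prop := Q (a - b) = 0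

theorem NullSeparated.symm {a b : V} (h : NullSeparated Q a b) : NullSeparated Q b a :=
  (Q.map_sub b a).trans h

/-- The Witt index of `Q` is at most one: orthogonal null vectors are parallel. -/
def WittIndexLeOne (Q : QuadraticForm K V) : Prop :=
  ∀ ⦃v w : V⦄, v ≠ 0 → Q v = 0 → Q w = 0 → polar Q v w = 0 → ∃ r : K, w = r • v

theorem quadraticForm_sub (Q : QuadraticForm K V) (a b : V) :
    Q (a - b) = Q a + Q b - polar Q a b := by
  rw [sub_eq_add_neg, QuadraticMap.map_add Q, QuadraticMap.map_neg, polar_neg_right,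
    sub_eq_add_neg]

theorem quadraticForm_lineMap (Q : QuadraticForm K V) (a b : V) (t : K) :
    Q (AffineMap.lineMap a b t) = (1 - t) * Q a + t * Q b - t * (1 - t) * Q (a - b) := by
  rw [AffineMap.lineMap_apply_module, QuadraticMap.map_add Q, QuadraticMap.map_smul,
    QuadraticMap.map_smul, polar_smul_left, polar_smul_right, quadraticForm_sub]
  simp only [smul_eq_mul]
  ring

theorem NullSeparated.lineMap_right {a b d : V} (hab : NullSeparated Q a b)
    (hda : NullSeparated Q d a) (hdb : NullSeparated Q d b) (t : K) :
    NullSeparated Q d (AffineMap.lineMap a b t) := by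
  have h : d - AffineMap.lineMap a b t = AffineMap.lineMap (d - a) (d - b) t := by
    simp only [AffineMap.lineMap_apply_module]
    module
  have hba := hab.symm
  rw [NullSeparated] at hba hda hdb ⊢
  rw [h, quadraticForm_lineMap, hda, hdb, sub_sub_sub_cancel_left, hba]
  ring

theorem WittIndexLeOne.exists_eq_lineMap (hQ : WittIndexLeOne Q) {a b e : V} (hne : a ≠ b)
    (hab : NullSeparated Q a b) (hae : NullSeparated Q a e) (hbe : NullSeparated Q b e) :
    ∃ t : K, e = AffineMap.lineMap a b t := by
  have hpolar : polar Q (a - b) (e - a) = 0 := by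
    rw [polar, sub_add_sub_cancel', hae.symm, hab, sub_zero, sub_zero]
    exact hbe.symm
  obtain ⟨r, hr⟩ := hQ (sub_ne_zero.2 hne) hab hae.symm hpolar
  refine ⟨-r, ?_⟩
  rw [AffineMap.lineMap_apply_module', ← sub_add_cancel e a, hr]
  module

theorem WittIndexLeOne.nullSeparated_of_mem_cones (hQ : WittIndexLeOne Q) {a b e f : V}
    (hne : a ≠ b) (hab : NullSeparated Q a b) (hae : NullSeparated Q a e)
    (hbe : NullSeparated Q b e) (haf : NullSeparated Q a f) (hbf : NullSeparated Q b f) :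
    NullSeparated Q e f := by
  obtain ⟨t, rfl⟩ := hQ.exists_eq_lineMap hne hab haf hbf
  exact hab.lineMap_right hae.symm hbe.symm t

theorem WittIndexLeOne.nullSeparated_of_nullSeparated (hQ : WittIndexLeOne Q) {a b d e f h : V}
    (hab : a ≠ b) (hef : e ≠ f) (hnull : NullSeparated Q a b)
    (hae : NullSeparated Q a e) (haf : NullSeparated Q a f) (hah : NullSeparated Q a h)
    (hbe : NullSeparated Q b e) (hbf : NullSeparated Q b f) (hbh : NullSeparated Q b h)
    (hde : NullSeparated Q d e) (hdf : NullSeparated Q d f) : NullSeparated Q d h := by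
  have hnull' : NullSeparated Q e f := hQ.nullSeparated_of_mem_cones hab hnull hae hbe haf hbf
  obtain ⟨t, rfl⟩ := hQ.exists_eq_lineMap hef hnull'
    (hQ.nullSeparated_of_mem_cones hab hnull hae hbe hah hbh)
    (hQ.nullSeparated_of_mem_cones hab hnull haf hbf hah hbh)
  exact hnull'.lineMap_right hde hdf t

/-- The quadratic form `(x, s, t) ↦ s t - Q x`, whose projectivized null cone is the conformal
compactification of `(V, Q)`. For the Minkowski form it has signature `(2, 4)`. -/
def conformalExtension (Q : QuadraticForm K V) : QuadraticForm K (V × K × K) :=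
  (-Q).prod (linMulLin (LinearMap.fst K K K) (LinearMap.snd K K K))

theorem polarBilin_conformalExtension (X Y : V × K × K) :
    polarBilin (conformalExtension Q) X Y =
      X.2.1 * Y.2.2 + X.2.2 * Y.2.1 - polar Q X.1 Y.1 := by
  rw [conformalExtension, polarBilin_apply_apply, polar_prod, FunLike.coe_neg, polar_neg]
  simp only [polar, linMulLin_apply, LinearMap.fst_apply, LinearMap.snd_apply, Prod.fst_add,
    Prod.snd_add]
  ring

theorem nondegenerate_conformalExtension (hQ : Q.polarBilin.Nondegenerate) :
    (conformalExtension Q).polarBilin.Nondegenerate := by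
  refine (LinearMap.IsRefl.nondegenerate_iff_separatingLeft
    fun X Y ↦ (polar_comm _ Y X).trans).2 fun X hX ↦ ?_
  simp only [polarBilin_conformalExtension] at hX
  refine Prod.ext (hQ.1 X.1 fun v ↦ ?_) (Prod.ext ?_ ?_)
  · simpa using hX (v, 0, 0)
  · simpa using hX (0, 0, 1)
  · simpa using hX (0, 1, 0)

/-- The point of the null cone of `conformalExtension Q` that represents the point `a` of `V`. -/
def conformalLift (Q : QuadraticForm K V) (a : V) : V × K × K := (a, 1, Q a)

theorem polarBilin_conformalLift (a b : V) :
    polarBilin (conformalExtension Q) (conformalLift Q a) (conformalLift Q b) = Q (a - b) := by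
  rw [polarBilin_conformalExtension, quadraticForm_sub]
  simp only [conformalLift]
  ring

theorem conformalLift_notMem_span_pair {a b c : V} (hca : c ≠ a) (hcb : c ≠ b)
    (hab : ¬ NullSeparated Q a b) :
    conformalLift Q c ∉ Submodule.span K {conformalLift Q a, conformalLift Q b} := by
  rw [Submodule.mem_span_pair]
  rintro ⟨s, t, h⟩
  simp only [conformalLift, Prod.smul_mk, Prod.mk_add_mk, Prod.mk.injEq, smul_eq_mul,
    mul_one] at h
  obtain ⟨hc, hst, hQc⟩ := h
  obtain rfl : s = 1 - t := eq_sub_of_add_eq hst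
  have hstewart := quadraticForm_lineMap Q a b t
  rw [AffineMap.lineMap_apply_module, hc, hQc, eq_comm, sub_eq_self] at hstewart
  rcases mul_eq_zero.1 hstewart with h | h
  · rcases mul_eq_zero.1 h with rfl | h
    · exact hca (by simpa using hc.symm)
    · rw [← sub_eq_zero.1 h] at hc
      exact hcb (by simpa using hc.symm)
  · exact hab h

theorem linearIndependent_conformalLift {a : Fin 3 → V} (ha : a.Injective)
    (hnull : ¬ NullSeparated Q (a 0) (a 1)) :
    LinearIndependent K fun i ↦ conformalLift Q (a i) := by
  have hpair : LinearIndependent K (Fin.init fun i ↦ conformalLift Q (a i)) := by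
    refine linearIndependent_fin2.2 ⟨by simp [Fin.init, conformalLift], fun r hr ↦ ?_⟩
    obtain ⟨h, rfl, -⟩ : r • a 1 = a 0 ∧ r = 1 ∧ r * Q (a 1) = Q (a 0) := by
      simpa [Fin.init, conformalLift] using hr
    exact ha.ne (by decide : (1 : Fin 3) ≠ 0) (by simpa using h)
  have hrange : range (Fin.init fun i ↦ conformalLift Q (a i)) =
      {conformalLift Q (a 0), conformalLift Q (a 1)} := by
    ext X
    simp [Fin.init, Fin.exists_fin_two, eq_comm]
  refine linearIndependent_finSucc'.2 ⟨hpair, ?_⟩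
  rw [hrange]
  exact conformalLift_notMem_span_pair (ha.ne (by decide : (2 : Fin 3) ≠ 0))
    (ha.ne (by decide : (2 : Fin 3) ≠ 1)) hnull

theorem bilinForm_eq_zero_of_linearIndependent [FiniteDimensional K V]
    {B : LinearMap.BilinForm K V} (hB : B.Nondegenerate) {ι κ : Type*} [Fintype ι] [Fintype κ]
    {u : ι → V} {v : κ → V} (hu : LinearIndependent K u) (hv : LinearIndependent K v)
    (hcard : Fintype.card ι + Fintype.card κ = finrank K V) (huv : ∀ i j, B (u i) (v j) = 0)
    {x y : V} (hx : ∀ j, B x (v j) = 0) (hy : ∀ i, B (u i) y = 0) : B x y = 0 := by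
  have mem_orthogonal {w : V} (hw : ∀ i, B (u i) w = 0) :
      w ∈ B.orthogonal (Submodule.span K (range u)) := by
    have hle : Submodule.span K (range u) ≤ LinearMap.ker (B.flip w) :=
      Submodule.span_le.2 (range_subset_iff.2 hw)
    exact fun z hz ↦ hle hz
  have hspan : Submodule.span K (range v) = B.orthogonal (Submodule.span K (range u)) := by
    refine Submodule.eq_of_le_of_finrank_eq
      (Submodule.span_le.2 (range_subset_iff.2 fun j ↦ mem_orthogonal fun i ↦ huv i j)) ?_
    rw [LinearMap.BilinForm.finrank_orthogonal hB, finrank_span_eq_card hu,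
      finrank_span_eq_card hv, ← hcard, Nat.add_sub_cancel_left]
  have hker : Submodule.span K (range v) ≤ LinearMap.ker (B x) :=
    Submodule.span_le.2 (range_subset_iff.2 hx)
  exact hker (hspan ▸ mem_orthogonal hy)

theorem WittIndexLeOne.nullSeparated_of_forall [FiniteDimensional K V] (hV : finrank K V = 4)
    (hdeg : Q.polarBilin.Nondegenerate) (hQ : WittIndexLeOne Q) {a e : Fin 3 → V} {d h : V}
    (ha : a.Injective) (he : e.Injective) (hae : ∀ i j, NullSeparated Q (a i) (e j))
    (hah : ∀ i, NullSeparated Q (a i) h) (hde : ∀ j, NullSeparated Q d (e j)) :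
    NullSeparated Q d h := by
  have h01 : (0 : Fin 3) ≠ 1 := by decide
  by_cases ha01 : NullSeparated Q (a 0) (a 1)
  · exact hQ.nullSeparated_of_nullSeparated (ha.ne h01) (he.ne h01) ha01 (hae 0 0) (hae 0 1)
      (hah 0) (hae 1 0) (hae 1 1) (hah 1) (hde 0) (hde 1)
  by_cases he01 : NullSeparated Q (e 0) (e 1)
  · exact (hQ.nullSeparated_of_nullSeparated (he.ne h01) (ha.ne h01) he01 (hae 0 0).symm
      (hae 1 0).symm (hde 0).symm (hae 0 1).symm (hae 1 1).symm (hde 1).symm (hah 0).symm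
      (hah 1).symm).symm
  have hcard : Fintype.card (Fin 3) + Fintype.card (Fin 3) = finrank K (V × K × K) := by
    simp [hV]
  simp only [NullSeparated, ← polarBilin_conformalLift] at hae hah hde ⊢
  exact bilinForm_eq_zero_of_linearIndependent (nondegenerate_conformalExtension hdeg)
    (linearIndependent_conformalLift ha ha01) (linearIndependent_conformalLift he he01)
    hcard hae hde hah

end QuadraticForm

section Minkowski

open QuadraticMap

theorem minkowskiForm_eq (u v : R4) :
    minkowskiForm u v = -(u 0 * v 0) + u 1 * v 1 + u 2 * v 2 + u 3 * v 3 := by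
  simp [minkowskiForm_apply, Fin.sum_univ_four, eta]

theorem eq_zero_of_minkowskiForm {v : R4} (h : ∀ w, minkowskiForm v w = 0) : v = 0 := by
  ext i
  have hi := h (EuclideanSpace.single i 1)
  rw [minkowskiForm_eq] at hi
  fin_cases i <;> simpa using hi

/-- The square `v ↦ η(v, v)` of a vector of Minkowski space. -/
def minkowskiQuadratic : QuadraticForm ℝ R4 := minkowskiForm.toBilinForm.toQuadraticMap

theorem polar_minkowskiQuadratic (u v : R4) :
    polar minkowskiQuadratic u v = 2 * minkowskiForm u v := by
  rw [minkowskiQuadratic, LinearMap.BilinMap.polar_toQuadraticMap, two_mul]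
  exact congrArg _ (minkowskiForm_symm v u)

theorem nondegenerate_polarBilin_minkowskiQuadratic :
    minkowskiQuadratic.polarBilin.Nondegenerate := by
  refine (LinearMap.IsRefl.nondegenerate_iff_separatingLeft
    fun u v ↦ (polar_comm _ v u).trans).2 fun u hu ↦ eq_zero_of_minkowskiForm fun v ↦ ?_
  simpa [polar_minkowskiQuadratic] using hu v

theorem apply_zero_ne_zero_of_minkowskiForm_self {v : R4} (hv0 : v ≠ 0)
    (hv : minkowskiForm v v = 0) : v 0 ≠ 0 := by
  intro h
  rw [minkowskiForm_eq, h] at hv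
  refine hv0 (PiLp.ext fun i ↦ pow_eq_zero_iff two_ne_zero |>.1 ?_)
  fin_cases i <;> simp <;> nlinarith [sq_nonneg (v 1), sq_nonneg (v 2), sq_nonneg (v 3)]

-- `w - r v` is null with vanishing time coordinate.
theorem wittIndexLeOne_minkowskiQuadratic : WittIndexLeOne minkowskiQuadratic := by
  intro v w hv0 hv hw hvw
  change minkowskiForm v v = 0 at hv
  change minkowskiForm w w = 0 at hw
  have hvw : minkowskiForm v w = 0 := by simpa [polar_minkowskiQuadratic] using hvw
  have hv₀ : v 0 ≠ 0 := apply_zero_ne_zero_of_minkowskiForm_self hv0 hv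
  refine ⟨w 0 / v 0, sub_eq_zero.1 (by_contra fun hne ↦ ?_)⟩
  refine apply_zero_ne_zero_of_minkowskiForm_self hne ?_ (by simp [hv₀])
  simp [hv, hw, hvw, minkowskiForm_symm w v]

end Minkowski

section Calculus

variable {E F : Type*} [NormedAddCommGroup E] [NormedSpace ℝ E] [NormedAddCommGroup F]
  [NormedSpace ℝ F]

/-- The Christoffel symbols of the first kind of a field `G` of bilinear forms on `E`, contracted
with `u`, `v` and `w`; on `ℝ⁴` this is the expression in `LorentzMetric.christoffel`. -/
def christoffelSymbol (G : E → E → E → ℝ) (y u v w : E) : ℝ :=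
  (1 / 2) * (fderiv ℝ (fun z ↦ G z v w) y u + fderiv ℝ (fun z ↦ G z u w) y v
    - fderiv ℝ (fun z ↦ G z u v) y w)

theorem christoffelSymbol_congr {G₁ G₂ : E → E → E → ℝ} {y : E} (h : G₁ =ᶠ[𝓝 y] G₂) :
    christoffelSymbol G₁ y = christoffelSymbol G₂ y := by
  have hfderiv (u v : E) : fderiv ℝ (fun z ↦ G₁ z u v) y = fderiv ℝ (fun z ↦ G₂ z u v) y :=
    (h.fun_comp fun G ↦ G u v).fderiv_eq
  ext u v w
  simp only [christoffelSymbol, hfderiv]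

/-- The pullback along `ψ` of the field of bilinear forms `lam B`, where `lam` is a function and
`B` is constant. -/
def conformalPullback (lam : F → ℝ) (B : F →L[ℝ] F →L[ℝ] ℝ) (ψ : E → F) (z u v : E) : ℝ :=
  lam (ψ z) * B (fderiv ℝ ψ z u) (fderiv ℝ ψ z v)

variable {lam : F → ℝ} {B : F →L[ℝ] F →L[ℝ] ℝ} {ψ : E → F}

theorem hasFDerivAt_fderiv {y : E} (hψ : ContDiffAt ℝ 2 ψ y) :
    HasFDerivAt (fderiv ℝ ψ) (fderiv ℝ (fderiv ℝ ψ) y) y :=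
  ((hψ.fderiv_right (m := 1) (by norm_num)).differentiableAt (by simp)).hasFDerivAt

theorem fderiv_conformalPullback {y : E} (hψ : ContDiffAt ℝ 2 ψ y)
    (hlam : DifferentiableAt ℝ lam (ψ y)) (u v w : E) :
    fderiv ℝ (fun z ↦ conformalPullback lam B ψ z u v) y w =
      fderiv ℝ lam (ψ y) (fderiv ℝ ψ y w) * B (fderiv ℝ ψ y u) (fderiv ℝ ψ y v)
        + lam (ψ y) * (B (fderiv ℝ (fderiv ℝ ψ) y w u) (fderiv ℝ ψ y v)
          + B (fderiv ℝ ψ y u) (fderiv ℝ (fderiv ℝ ψ) y w v)) := by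
  have hd : HasFDerivAt ψ (fderiv ℝ ψ y) y := (hψ.differentiableAt (by simp)).hasFDerivAt
  have hu := (hasFDerivAt_fderiv hψ).clm_apply (hasFDerivAt_const u y)
  have hv := (hasFDerivAt_fderiv hψ).clm_apply (hasFDerivAt_const v y)
  have hB := (B.hasFDerivAt.comp y hu).clm_apply hv
  refine (DFunLike.congr_fun ((hlam.hasFDerivAt.comp y hd).mul hB).fderiv w).trans ?_
  simp
  ring

theorem christoffelSymbol_conformalPullback_self (hB : ∀ a b, B a b = B b a) {y : E}
    (hψ : ContDiffAt ℝ 2 ψ y) (hlam : DifferentiableAt ℝ lam (ψ y)) (u w : E) :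
    christoffelSymbol (conformalPullback lam B ψ) y u u w =
      B (lam (ψ y) • fderiv ℝ (fderiv ℝ ψ) y u u
          + fderiv ℝ lam (ψ y) (fderiv ℝ ψ y u) • fderiv ℝ ψ y u) (fderiv ℝ ψ y w)
        - 1 / 2 * (fderiv ℝ lam (ψ y) (fderiv ℝ ψ y w) * B (fderiv ℝ ψ y u) (fderiv ℝ ψ y u)) := by
  have hsymm : fderiv ℝ (fderiv ℝ ψ) y w u = fderiv ℝ (fderiv ℝ ψ) y u w :=
    hψ.isSymmSndFDerivAt (by simp) w u
  simp only [christoffelSymbol, fderiv_conformalPullback hψ hlam, hsymm, map_add, map_smul,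
    add_apply, smul_apply, smul_eq_mul]
  rw [hB (fderiv ℝ (fderiv ℝ ψ) y u w)]
  ring

theorem differentiableAt_deriv {c : ℝ → E} {t : ℝ} (hc : ContDiffAt ℝ 2 c t) :
    DifferentiableAt ℝ (deriv c) t :=
  (hasFDerivAt_fderiv hc).differentiableAt.clm_apply (differentiableAt_const 1)

theorem deriv_comp_eventuallyEq {c : ℝ → E} {t : ℝ} (hψ : ContDiffAt ℝ 1 ψ (c t))
    (hc : ContDiffAt ℝ 1 c t) : deriv (ψ ∘ c) =ᶠ[𝓝 t] fun s ↦ fderiv ℝ ψ (c s) (deriv c s) := by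
  filter_upwards [hc.continuousAt.eventually (hψ.eventually (by simp)), hc.eventually (by simp)]
    with s hψs hcs
  exact fderiv_comp_deriv s (hψs.differentiableAt (by simp)) (hcs.differentiableAt (by simp))

theorem hasDerivAt_deriv_comp {c : ℝ → E} {t : ℝ} (hψ : ContDiffAt ℝ 2 ψ (c t))
    (hc : ContDiffAt ℝ 2 c t) :
    HasDerivAt (deriv (ψ ∘ c)) (fderiv ℝ (fderiv ℝ ψ) (c t) (deriv c t) (deriv c t)
      + fderiv ℝ ψ (c t) (deriv (deriv c) t)) t :=
  (((hasFDerivAt_fderiv hψ).comp_hasDerivAt t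
    (hc.differentiableAt (by simp)).hasDerivAt).clm_apply
      (differentiableAt_deriv hc).hasDerivAt).congr_of_eventuallyEq
    (deriv_comp_eventuallyEq (hψ.of_le one_le_two) (hc.of_le one_le_two))

theorem conformalPullback_deriv_deriv_add_christoffelSymbol (hB : ∀ a b, B a b = B b a)
    {c : ℝ → E} {t : ℝ} (hψ : ContDiffAt ℝ 2 ψ (c t)) (hc : ContDiffAt ℝ 2 c t)
    (hlam : DifferentiableAt ℝ lam (ψ (c t)))
    (hnull : B (deriv (ψ ∘ c) t) (deriv (ψ ∘ c) t) = 0) (w : E) :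
    conformalPullback lam B ψ (c t) (deriv (deriv c) t) w
        + christoffelSymbol (conformalPullback lam B ψ) (c t) (deriv c t) (deriv c t) w =
      B (deriv (fun s ↦ lam ((ψ ∘ c) s) • deriv (ψ ∘ c) s) t) (fderiv ℝ ψ (c t) w) := by
  have hx : deriv (ψ ∘ c) t = fderiv ℝ ψ (c t) (deriv c t) :=
    fderiv_comp_deriv t (hψ.differentiableAt (by simp)) (hc.differentiableAt (by simp))
  have hlamx : HasDerivAt (fun s ↦ lam ((ψ ∘ c) s))
      (fderiv ℝ lam (ψ (c t)) (deriv (ψ ∘ c) t)) t :=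
    hlam.hasFDerivAt.comp_hasDerivAt t
      ((hψ.comp t hc).differentiableAt (by simp)).hasDerivAt
  rw [(hlamx.fun_smul (hasDerivAt_deriv_comp hψ hc)).deriv,
    christoffelSymbol_conformalPullback_self hB hψ hlam, ← hx, hnull, conformalPullback]
  simp only [map_add, map_smul, add_apply, smul_apply, smul_eq_mul, Function.comp_apply]
  ring

theorem exists_sub_eq_smul_of_hasDerivAt [CompleteSpace F] {x : ℝ → F} {ρ : ℝ → ℝ} {V : F} {s t : ℝ}
    (hx : ∀ r ∈ uIcc s t, HasDerivAt x (ρ r • V) r) (hρ : ContinuousOn ρ (uIcc s t)) :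
    ∃ k : ℝ, x t - x s = k • V :=
  ⟨∫ r in s..t, ρ r, by
    rw [← intervalIntegral.integral_smul_const,
      intervalIntegral.integral_eq_sub_of_hasDerivAt hx
        (hρ.smul continuousOn_const).intervalIntegrable]⟩

theorem exists_openPartialHomeomorph_hasDerivAt {ρ : ℝ → ℝ} (hρ : ContDiff ℝ ∞ ρ)
    (hpos : ∀ τ, 0 < ρ τ) : ∃ e : OpenPartialHomeomorph ℝ ℝ, e.source = univ ∧
      e.target.OrdConnected ∧ ∀ s ∈ e.target, ContDiffAt ℝ ∞ e.symm s ∧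
        HasDerivAt e.symm (ρ (e.symm s))⁻¹ s := by
  let T : ℝ → ℝ := fun τ ↦ ∫ r in (0 : ℝ)..τ, ρ r
  have hT (τ : ℝ) : HasStrictDerivAt T (ρ τ) τ := hρ.continuous.integral_hasStrictDerivAt 0 τ
  have hderiv : deriv T = ρ := funext fun τ ↦ (hT τ).hasDerivAt.deriv
  have hsmooth : ContDiff ℝ ∞ T :=
    contDiff_infty_iff_deriv.2 ⟨fun τ ↦ (hT τ).hasDerivAt.differentiableAt, hderiv ▸ hρ⟩
  have hmono : StrictMono T := strictMono_of_deriv_pos fun τ ↦ hderiv ▸ hpos τ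
  have hemb : IsOpenEmbedding T := .of_continuous_injective_isOpenMap hsmooth.continuous
    hmono.injective (isOpenMap_of_hasStrictDerivAt hT fun τ ↦ (hpos τ).ne')
  refine ⟨hemb.toOpenPartialHomeomorph T, by simp, ?_, fun s hs ↦ ⟨?_, ?_⟩⟩
  · simpa using (isPreconnected_range hsmooth.continuous).ordConnected
  · exact (hemb.toOpenPartialHomeomorph T).contDiffAt_symm_deriv (hpos _).ne' hs
      (hT _).hasDerivAt hsmooth.contDiffAt
  · exact (hemb.toOpenPartialHomeomorph T).hasDerivAt_symm hs (hpos _).ne' (hT _).hasDerivAt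

theorem exists_curve_smul_deriv_eq_sub (hlam : ContDiff ℝ ∞ lam) (hpos : ∀ q, 0 < lam q)
    (a b : F) : ∃ (x : ℝ → F) (J : Set ℝ), IsOpen J ∧ J.OrdConnected ∧ ContDiffOn ℝ ∞ x J ∧
      (∀ s ∈ J, lam (x s) • deriv x s = b - a) ∧ ∃ s ∈ J, ∃ t ∈ J, x s = a ∧ x t = b := by
  have hline : ContDiff ℝ ∞ (AffineMap.lineMap a b : ℝ → F) :=
    contDiff_const.lineMap contDiff_const contDiff_id
  obtain ⟨e, hsource, hord, he⟩ := exists_openPartialHomeomorph_hasDerivAt (hlam.comp hline)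
    fun _ ↦ hpos _
  have hmem (τ : ℝ) : e τ ∈ e.target := e.map_source (hsource ▸ mem_univ τ)
  have hleft (τ : ℝ) : e.symm (e τ) = τ := e.left_inv (hsource ▸ mem_univ τ)
  refine ⟨fun s ↦ AffineMap.lineMap a b (e.symm s), e.target, e.open_target, hord,
    fun s hs ↦ (hline.contDiffAt.comp s (he s hs).1).contDiffWithinAt, fun s hs ↦ ?_,
    e 0, hmem 0, e 1, hmem 1, by simp [hleft], by simp [hleft]⟩
  have hd : HasDerivAt (fun s ↦ AffineMap.lineMap a b (e.symm s)) _ s :=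
    AffineMap.hasDerivAt_lineMap.scomp s (he s hs).2
  rw [hd.deriv]
  exact smul_inv_smul₀ (hpos _).ne' _

end Calculus

section MVFDeriv

variable {𝕜 : Type*} [NontriviallyNormedField 𝕜]
  {E F G : Type*} [NormedAddCommGroup E] [NormedSpace 𝕜 E] [NormedAddCommGroup F] [NormedSpace 𝕜 F]
  [NormedAddCommGroup G] [NormedSpace 𝕜 G]
  {H : Type*} [TopologicalSpace H] {I : ModelWithCorners 𝕜 E H}
  {N : Type*} [TopologicalSpace N] [ChartedSpace H N]

theorem fderiv_comp_apply_eq_mvfderiv {φ : N → F} {χ : G → N} {y : G}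
    (hφ : MDifferentiableAt I 𝓘(𝕜, F) φ (χ y)) (hχ : MDifferentiableAt 𝓘(𝕜, G) I χ y) (u : G) :
    fderiv 𝕜 (φ ∘ χ) y u = mvfderiv I φ (χ y)
      (mfderiv 𝓘(𝕜, G) I χ y ((NormedSpace.fromTangentSpace y).symm u)) := by
  have hcomp : fderiv 𝕜 (φ ∘ χ) y = _ := mfderiv_eq_fderiv.symm.trans (mfderiv_comp y hφ hχ)
  exact congrArg (fun L : G →L[𝕜] F ↦ L u) hcomp

theorem mvfderiv_bijective {n : ℕ∞ω} (φ : N ≃ₘ^n⟮I, 𝓘(𝕜, F)⟯ F) (hn : n ≠ 0) (p : N) :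
    Function.Bijective (mvfderiv I φ p) :=
  (NormedSpace.fromTangentSpace (φ p)).bijective.comp
    (φ.mfderivToContinuousLinearEquiv hn p).bijective

end MVFDeriv

variable {M : Type*} [TopologicalSpace M] [ChartedSpace R4 M]

theorem mvfderiv_mfderiv_symm (φ : M ≃ₘ⟮𝓡 4, 𝓡 4⟯ R4) (q v : R4) :
    mvfderiv (𝓡 4) φ (φ.symm q)
      (mfderiv (𝓡 4) (𝓡 4) φ.symm q ((NormedSpace.fromTangentSpace q).symm v)) = v := by
  have hid : (φ ∘ φ.symm : R4 → R4) = id := φ.self_comp_symm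
  rw [← fderiv_comp_apply_eq_mvfderiv (φ.contMDiff.mdifferentiableAt (by simp))
    (φ.symm.contMDiff.mdifferentiableAt (by simp)), hid, fderiv_id]
  rfl

theorem deriv_comp_eq_mvfderiv_velocity {φ : M ≃ₘ⟮𝓡 4, 𝓡 4⟯ R4} {γ : ℝ → M} {t : ℝ}
    (hγ : MDifferentiableAt 𝓘(ℝ, ℝ) (𝓡 4) γ t) :
    deriv (φ ∘ γ) t = mvfderiv (𝓡 4) φ (γ t) (velocity γ t) :=
  fderiv_comp_apply_eq_mvfderiv (φ.contMDiff.mdifferentiableAt (by simp)) hγ 1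

theorem contDiffAt_comp {F : Type*} [NormedAddCommGroup F] [NormedSpace ℝ F]
    (φ : M ≃ₘ⟮𝓡 4, 𝓡 4⟯ R4) {χ : F → M} {y : F} (hχ : ContMDiffAt 𝓘(ℝ, F) (𝓡 4) ∞ χ y) :
    ContDiffAt ℝ ∞ (φ ∘ χ) y :=
  (φ.contMDiff.contMDiffAt.comp y hχ).contDiffAt

variable [IsManifold (𝓡 4) ∞ M]

section Chart

variable {p : M} {y : R4}

theorem contMDiffAt_extChartAt_symm (hy : y ∈ (extChartAt (𝓡 4) p).target) :
    ContMDiffAt 𝓘(ℝ, R4) (𝓡 4) ∞ (extChartAt (𝓡 4) p).symm y :=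
  (contMDiffOn_extChartAt_symm p).contMDiffAt ((isOpen_extChartAt_target p).mem_nhds hy)

theorem fderiv_comp_extChartAt_symm (φ : M ≃ₘ⟮𝓡 4, 𝓡 4⟯ R4)
    (hy : y ∈ (extChartAt (𝓡 4) p).target) (u : R4) :
    fderiv ℝ (φ ∘ (extChartAt (𝓡 4) p).symm) y u =
      mvfderiv (𝓡 4) φ ((extChartAt (𝓡 4) p).symm y)
        (mfderiv 𝓘(ℝ, R4) (𝓡 4) (extChartAt (𝓡 4) p).symm y
          ((NormedSpace.fromTangentSpace y).symm u)) :=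
  fderiv_comp_apply_eq_mvfderiv (φ.contMDiff.mdifferentiableAt (by simp))
    ((contMDiffAt_extChartAt_symm hy).mdifferentiableAt (by simp)) u

theorem fderiv_comp_extChartAt_symm_surjective (φ : M ≃ₘ⟮𝓡 4, 𝓡 4⟯ R4)
    (hy : y ∈ (extChartAt (𝓡 4) p).target) :
    Function.Surjective (fderiv ℝ (φ ∘ (extChartAt (𝓡 4) p).symm) y) := by
  have hinv := isInvertible_mfderivWithin_extChartAt_symm hy
  rw [ModelWithCorners.range_eq_univ, mfderivWithin_univ] at hinv
  have hsurj := ((mvfderiv_bijective φ (by simp) _).comp (hinv.bijective.comp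
    (NormedSpace.fromTangentSpace (𝕜 := ℝ) y).symm.bijective)).surjective
  exact fun v ↦ (hsurj v).imp fun u hu ↦ (fderiv_comp_extChartAt_symm φ hy u).trans hu

end Chart

theorem LorentzMetric.contDiff_inner_mfderiv {F : Type*} [NormedAddCommGroup F] [NormedSpace ℝ F]
    (g : LorentzMetric M) {χ : F → M} (hχ : ContMDiff 𝓘(ℝ, F) (𝓡 4) ∞ χ) (u v : F) :
    ContDiff ℝ ∞ fun q : F ↦ g.inner (χ q)
      (mfderiv 𝓘(ℝ, F) (𝓡 4) χ q ((NormedSpace.fromTangentSpace q).symm u))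
      (mfderiv 𝓘(ℝ, F) (𝓡 4) χ q ((NormedSpace.fromTangentSpace q).symm v)) := by
  have hfield (w : F) : ContMDiff 𝓘(ℝ, F) (𝓡 4).tangent ∞ fun q : F ↦
      (⟨χ q, mfderiv 𝓘(ℝ, F) (𝓡 4) χ q ((NormedSpace.fromTangentSpace q).symm w)⟩ :
        TangentBundle (𝓡 4) M) := by
    have hconst : ContMDiff 𝓘(ℝ, F) 𝓘(ℝ, F).tangent ∞ fun q : F ↦
        (⟨q, (NormedSpace.fromTangentSpace q).symm w⟩ : TangentBundle 𝓘(ℝ, F) F) :=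
      fun q ↦ contMDiffAt_vectorSpace_iff_contDiffAt.2 contDiffAt_const
    exact (hχ.contMDiff_tangentMap (m := ∞) le_rfl).comp hconst
  have hinner : ContMDiff 𝓘(ℝ, F) ((𝓡 4).prod 𝓘(ℝ)) ∞ fun q : F ↦
      Bundle.TotalSpace.mk' ℝ (E := Bundle.Trivial M ℝ) (χ q) (g.inner (χ q)
        (mfderiv 𝓘(ℝ, F) (𝓡 4) χ q ((NormedSpace.fromTangentSpace q).symm u))
        (mfderiv 𝓘(ℝ, F) (𝓡 4) χ q ((NormedSpace.fromTangentSpace q).symm v))) :=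
    (g.contMDiff.comp hχ).clm_bundle_apply₂ (F₁ := R4) (F₂ := R4) (hfield u) (hfield v)
  exact contMDiff_iff_contDiff.1 fun q ↦ (Bundle.contMDiffAt_totalSpace.1 (hinner q)).2

/-- In the global coordinates `φ`, the metric `g` is `lam η` with `lam` smooth and positive; in
the notation of `ConformallyFlat`, `lam` is `Ω⁻²` transported to `ℝ⁴`. -/
structure IsConformalFactor (g : LorentzMetric M) (φ : M ≃ₘ⟮𝓡 4, 𝓡 4⟯ R4) (lam : R4 → ℝ) :
    Prop where
  contDiff : ContDiff ℝ ∞ lam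
  pos (q : R4) : 0 < lam q
  inner_eq (p : M) (u v : TangentSpace (𝓡 4) p) :
    g.inner p u v =
      lam (φ p) * minkowskiForm (mvfderiv (𝓡 4) φ p u) (mvfderiv (𝓡 4) φ p v)

variable {g : LorentzMetric M}

theorem ConformallyFlat.exists_isConformalFactor (hg : ConformallyFlat g) :
    ∃ (φ : M ≃ₘ⟮𝓡 4, 𝓡 4⟯ R4) (lam : R4 → ℝ), IsConformalFactor g φ lam := by
  obtain ⟨φ, Ω, hΩ, hφ⟩ := hg
  have inner_eq (p : M) (u v : TangentSpace (𝓡 4) p) : g.inner p u v =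
      (Ω p ^ 2)⁻¹ * minkowskiForm (mvfderiv (𝓡 4) φ p u) (mvfderiv (𝓡 4) φ p v) := by
    rw [eq_inv_mul_iff_mul_eq₀ (pow_ne_zero 2 (hΩ p)), ← hφ]
    exact minkowskiInner_apply _ _ _
  refine ⟨φ, fun q ↦ (Ω (φ.symm q) ^ 2)⁻¹, ?_, fun q ↦ ?_, fun p u v ↦ ?_⟩
  · -- The factor is minus the square of the coordinate field `∂/∂t`.
    have hsmooth := (g.contDiff_inner_mfderiv φ.symm.contMDiff
      (EuclideanSpace.single 0 1) (EuclideanSpace.single 0 1)).neg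
    simp only [inner_eq, mvfderiv_mfderiv_symm] at hsmooth
    simpa [minkowskiForm_eq] using hsmooth
  · exact inv_pos.2 (pow_two_pos_of_ne_zero (hΩ _))
  · rw [inner_eq, φ.symm_apply_apply]

namespace IsConformalFactor

variable {φ : M ≃ₘ⟮𝓡 4, 𝓡 4⟯ R4} {lam : R4 → ℝ}

theorem isLightlike_velocity_iff (h : IsConformalFactor g φ lam) {γ : ℝ → M} {t : ℝ}
    (hγ : MDifferentiableAt 𝓘(ℝ, ℝ) (𝓡 4) γ t) : IsLightlike g (velocity γ t) ↔
      deriv (φ ∘ γ) t ≠ 0 ∧ minkowskiForm (deriv (φ ∘ γ) t) (deriv (φ ∘ γ) t) = 0 := by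
  rw [IsLightlike, h.inner_eq, deriv_comp_eq_mvfderiv_velocity hγ, mul_eq_zero,
    or_iff_right (h.pos _).ne', Ne, Ne,
    map_eq_zero_iff _ (mvfderiv_bijective φ (by simp) (γ t)).injective]

theorem coord_eventuallyEq (h : IsConformalFactor g φ lam) {p : M} {y : R4}
    (hy : y ∈ (extChartAt (𝓡 4) p).target) :
    g.coord p =ᶠ[𝓝 y] conformalPullback lam minkowskiForm (φ ∘ (extChartAt (𝓡 4) p).symm) := by
  filter_upwards [(isOpen_extChartAt_target p).mem_nhds hy] with z hz
  ext u v
  rw [LorentzMetric.coord, h.inner_eq, ← fderiv_comp_extChartAt_symm φ hz,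
    ← fderiv_comp_extChartAt_symm φ hz]
  rfl

theorem geodesicEqAt_iff (h : IsConformalFactor g φ lam) {γ : ℝ → M} {t : ℝ}
    (hγ : ContMDiffAt 𝓘(ℝ, ℝ) (𝓡 4) ∞ γ t)
    (hnull : minkowskiForm (deriv (φ ∘ γ) t) (deriv (φ ∘ γ) t) = 0) :
    GeodesicEqAt g γ t ↔ deriv (fun s ↦ lam ((φ ∘ γ) s) • deriv (φ ∘ γ) s) t = 0 := by
  set p := γ t
  set ψ : R4 → R4 := φ ∘ (extChartAt (𝓡 4) p).symm
  set c : ℝ → R4 := extChartAt (𝓡 4) p ∘ γ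
  have hct : c t ∈ (extChartAt (𝓡 4) p).target := mem_extChartAt_target p
  have hc : ContDiffAt ℝ ∞ c t := ((contMDiffAt_extChartAt (x := p)).comp t hγ).contDiffAt
  have hψ : ContDiffAt ℝ ∞ ψ (c t) := contDiffAt_comp φ (contMDiffAt_extChartAt_symm hct)
  have hψc : φ ∘ γ =ᶠ[𝓝 t] ψ ∘ c := by
    filter_upwards [hγ.continuousAt (extChartAt_source_mem_nhds (I := 𝓡 4) p)] with s hs
    exact congrArg φ ((extChartAt (𝓡 4) p).left_inv hs).symm
  have hmomentum : (fun s ↦ lam ((φ ∘ γ) s) • deriv (φ ∘ γ) s) =ᶠ[𝓝 t]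
      fun s ↦ lam ((ψ ∘ c) s) • deriv (ψ ∘ c) s :=
    (hψc.fun_comp lam).smul hψc.deriv
  rw [hψc.deriv_eq] at hnull
  have hgeodesic (w : R4) :
      g.coord p (c t) (deriv (deriv c) t) w + g.christoffel p (c t) (deriv c t) (deriv c t) w =
        minkowskiForm (deriv (fun s ↦ lam ((φ ∘ γ) s) • deriv (φ ∘ γ) s) t)
          (fderiv ℝ ψ (c t) w) := by
    change _ + christoffelSymbol (g.coord p) (c t) (deriv c t) (deriv c t) w = _
    rw [hmomentum.deriv_eq, christoffelSymbol_congr (h.coord_eventuallyEq hct),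
      (h.coord_eventuallyEq hct).self_of_nhds]
    exact conformalPullback_deriv_deriv_add_christoffelSymbol minkowskiForm_symm
      (hψ.of_le ENat.LEInfty.out) (hc.of_le ENat.LEInfty.out)
      (h.contDiff.differentiable (by simp) _) hnull w
  change (∀ w : R4, g.coord p (c t) (deriv (deriv c) t) w
    + g.christoffel p (c t) (deriv c t) (deriv c t) w = 0) ↔ _
  simp only [hgeodesic]
  refine ⟨fun H ↦ eq_zero_of_minkowskiForm
    ((fderiv_comp_extChartAt_symm_surjective φ hct).forall.2 H), fun H w ↦ by rw [H]; simp⟩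

theorem exists_smul_deriv_eq (h : IsConformalFactor g φ lam) {γ : ℝ → M} {J : Set ℝ}
    (hγ : IsLightlikeGeodesicOn g γ J) :
    ∃ V : R4, ∀ s ∈ J, lam ((φ ∘ γ) s) • deriv (φ ∘ γ) s = V := by
  have hsmooth (s) (hs : s ∈ J) : ContMDiffAt 𝓘(ℝ, ℝ) (𝓡 4) ∞ γ s :=
    hγ.smooth.contMDiffAt (hγ.isOpen.mem_nhds hs)
  have hx (s) (hs : s ∈ J) : ContDiffAt ℝ ∞ (φ ∘ γ) s := contDiffAt_comp φ (hsmooth s hs)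
  refine hγ.isOpen.exists_is_const_of_deriv_eq_zero hγ.ordConnected.isPreconnected
    (fun s hs ↦ ?_) fun s hs ↦ ?_
  · have hlam : DifferentiableAt ℝ (fun s ↦ lam ((φ ∘ γ) s)) s :=
      (h.contDiff.differentiable (by simp) _).comp s ((hx s hs).differentiableAt (by simp))
    exact (hlam.smul
      (differentiableAt_deriv ((hx s hs).of_le ENat.LEInfty.out))).differentiableWithinAt
  · have hnull := (h.isLightlike_velocity_iff ((hsmooth s hs).mdifferentiableAt (by simp))).1
      (hγ.lightlike s hs)
    exact (h.geodesicEqAt_iff (hsmooth s hs) hnull.2).1 (hγ.geodesic s hs)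

theorem isLightlikeGeodesicOn (h : IsConformalFactor g φ lam) {x : ℝ → R4} {J : Set ℝ} {V : R4}
    (hJ : IsOpen J) (hord : J.OrdConnected) (hx : ContDiffOn ℝ ∞ x J)
    (hxV : ∀ s ∈ J, lam (x s) • deriv x s = V) (hV0 : V ≠ 0) (hV : minkowskiForm V V = 0) :
    IsLightlikeGeodesicOn g (φ.symm ∘ x) J := by
  have hφx : φ ∘ φ.symm ∘ x = x := by
    ext1 s
    simp
  have hsmooth : ContMDiffOn 𝓘(ℝ, ℝ) (𝓡 4) ∞ (φ.symm ∘ x) J :=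
    φ.symm.contMDiff.comp_contMDiffOn hx.contMDiffOn
  have hsmoothAt (s) (hs : s ∈ J) : ContMDiffAt 𝓘(ℝ, ℝ) (𝓡 4) ∞ (φ.symm ∘ x) s :=
    hsmooth.contMDiffAt (hJ.mem_nhds hs)
  have hderiv (s) (hs : s ∈ J) : deriv x s = (lam (x s))⁻¹ • V := by
    rw [← hxV s hs, inv_smul_smul₀ (h.pos _).ne']
  have hnull (s) (hs : s ∈ J) : minkowskiForm (deriv x s) (deriv x s) = 0 := by
    simp [hderiv s hs, hV]
  refine ⟨hJ, hord, hsmooth, fun s hs ↦ ?_, fun s hs ↦ ?_⟩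
  · rw [h.geodesicEqAt_iff (hsmoothAt s hs) (by rw [hφx]; exact hnull s hs), hφx]
    have hconst : (fun r ↦ lam (x r) • deriv x r) =ᶠ[𝓝 s] fun _ ↦ V :=
      eventually_of_mem (hJ.mem_nhds hs) hxV
    rw [hconst.deriv_eq, deriv_const]
  · rw [h.isLightlike_velocity_iff ((hsmoothAt s hs).mdifferentiableAt (by simp)), hφx]
    exact ⟨hderiv s hs ▸ smul_ne_zero (inv_ne_zero (h.pos _).ne') hV0, hnull s hs⟩

theorem nullSeparated_of_lightCone (h : IsConformalFactor g φ lam) {A B : M}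
    (hAB : LightCone g A B) : NullSeparated minkowskiQuadratic (φ A) (φ B) := by
  obtain ⟨γ, J, hγ, s, hs, t, ht, rfl, rfl⟩ := hAB
  obtain ⟨V, hV⟩ := h.exists_smul_deriv_eq hγ
  have hsmooth (r) (hr : r ∈ J) : ContMDiffAt 𝓘(ℝ, ℝ) (𝓡 4) ∞ γ r :=
    hγ.smooth.contMDiffAt (hγ.isOpen.mem_nhds hr)
  have hx (r) (hr : r ∈ J) : DifferentiableAt ℝ (φ ∘ γ) r :=
    (contDiffAt_comp φ (hsmooth r hr)).differentiableAt (by simp)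
  have hts : uIcc t s ⊆ J := hγ.ordConnected.uIcc_subset ht hs
  have hVnull : minkowskiForm V V = 0 := by
    have hnull := (h.isLightlike_velocity_iff ((hsmooth s hs).mdifferentiableAt (by simp))).1
      (hγ.lightlike s hs)
    simp [← hV s hs, hnull.2]
  obtain ⟨k, hk⟩ := exists_sub_eq_smul_of_hasDerivAt (x := φ ∘ γ) (V := V) (s := t) (t := s)
    (ρ := fun r ↦ (lam ((φ ∘ γ) r))⁻¹)
    (fun r hr ↦ by
      rw [← hV r (hts hr), inv_smul_smul₀ (h.pos _).ne']
      exact (hx r (hts hr)).hasDerivAt)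
    (fun r hr ↦ ((h.contDiff.continuous.continuousAt.comp (hx r (hts hr)).continuousAt).inv₀
      (h.pos _).ne').continuousWithinAt)
  change minkowskiForm ((φ ∘ γ) s - (φ ∘ γ) t) ((φ ∘ γ) s - (φ ∘ γ) t) = 0
  rw [hk]
  simp [hVnull]

theorem lightCone_of_nullSeparated (h : IsConformalFactor g φ lam) {A B : M} (hne : A ≠ B)
    (hAB : NullSeparated minkowskiQuadratic (φ A) (φ B)) : LightCone g A B := by
  obtain ⟨x, J, hJ, hord, hx, hxV, s, hs, t, ht, hxs, hxt⟩ :=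
    exists_curve_smul_deriv_eq_sub h.contDiff h.pos (φ A) (φ B)
  exact ⟨φ.symm ∘ x, J, h.isLightlikeGeodesicOn hJ hord hx hxV
    (sub_ne_zero.2 (φ.injective.ne hne.symm)) hAB.symm, s, hs, t, ht, by simp [hxs], by simp [hxt]⟩

end IsConformalFactor

end Spacetime

end

theorem corollary1 {M : Type*} [TopologicalSpace M] [ChartedSpace Spacetime.R4 M]
    [IsManifold (𝓡 4) ∞ M] (g : Spacetime.LorentzMetric M)
    (hg : Spacetime.ConformallyFlat g) : Spacetime.WellStitched g := by
  obtain ⟨φ, lam, h⟩ := hg.exists_isConformalFactor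
  intro A B C D E F G H hnodup hAE hAF hAG hAH hBE hBF hBG hBH hCE hCF hCG hCH hDE hDF hDG
  have hABC : Function.Injective ![A, B, C] :=
    List.nodup_ofFn.1 (List.IsInfix.sublist ⟨[], [D, E, F, G, H], rfl⟩ |>.nodup hnodup)
  have hEFG : Function.Injective ![E, F, G] :=
    List.nodup_ofFn.1 (List.IsInfix.sublist ⟨[A, B, C, D], [H], rfl⟩ |>.nodup hnodup)
  have hDH : D ≠ H := by
    simp only [List.nodup_cons, List.mem_cons, not_or] at hnodup
    tauto
  refine h.lightCone_of_nullSeparated hDH ?_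
  refine Spacetime.wittIndexLeOne_minkowskiQuadratic.nullSeparated_of_forall (by simp)
    Spacetime.nondegenerate_polarBilin_minkowskiQuadratic (φ.injective.comp hABC)
    (φ.injective.comp hEFG) (fun i j ↦ ?_) (fun i ↦ ?_) fun j ↦ ?_
  · fin_cases i <;> fin_cases j <;> exact h.nullSeparated_of_lightCone ‹_›
  · fin_cases i <;> exact h.nullSeparated_of_lightCone ‹_›
  · fin_cases j <;> exact h.nullSeparated_of_lightCone ‹_›
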